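/- Let $n\ge 1$ and $k\ge 1$ be integers. Let $\mathcal{M}(\mathbb{Z}^n,k)$ be the family of all inclusion-maximal $n$-dimensional convex sets in $\mathbb{R}^n$ with precisely $k$ integer points in the interior; that is, $M\in\mathcal{M}(\mathbb{Z}^n,k)$ if and only if $M\subseteq\mathbb{R}^n$ is an $n$-dimensional convex set with $|\operatorname{int}(M)\cap\mathbb{Z}^n|=k$ such that every convex set $M'\subseteq\mathbb{R}^n$ with $M\subseteq M'$ and $\operatorname{int}(M')\cap\mathbb{Z}^n=\operatorname{int}(M)\cap\mathbb{Z}^n$ satisfies $M'=M$. Then $\mathcal{M}(\mathbb{Z}^n,k)$ is the set of all $n$-dimensional polytopes $P\subseteq\mathbb{R}^n$ with precisely $k$ interior integer points such that the relative interior of every facet of $P$ contains a point of $\mathbb{Z}^n$. (A polytope is the convex hull of a finite set of points; a facet of $P$ is a non-empty face of $P$ of dimension $\dim(P)-1$.) -/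

import Mathlib

/-- `C` is non-empty and its affine hull has dimension `d`. -/
def HasDim {n : ℕ} (C : Set (EuclideanSpace ℝ (Fin n))) (d : ℕ) : Prop :=
  C.Nonempty ∧ Module.finrank ℝ (vectorSpan ℝ C) = d

/-- The integer points `ℤⁿ` of `ℝⁿ`. -/
def integerPoints (n : ℕ) : Set (EuclideanSpace ℝ (Fin n)) :=
  {x | ∀ i, ∃ z : ℤ, x i = (z : ℝ)}

/-- The family of all inclusion-maximal `n`-dimensional convex sets with precisely `k` points of
`S` in the interior. -/
def maximalConvexSets {n : ℕ} (S : Set (EuclideanSpace ℝ (Fin n))) (k : ℕ) :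
    Set (Set (EuclideanSpace ℝ (Fin n))) :=
  {M | Convex ℝ M ∧ HasDim M n ∧ (interior M ∩ S).encard = (k : ℕ∞) ∧
    ∀ M' : Set (EuclideanSpace ℝ (Fin n)), Convex ℝ M' → M ⊆ M' →
      interior M' ∩ S = interior M ∩ S → M = M'}

/-- A polytope is the convex hull of finitely many points. -/
def IsPolytope {n : ℕ} (P : Set (EuclideanSpace ℝ (Fin n))) : Prop :=
  ∃ V : Finset (EuclideanSpace ℝ (Fin n)), P = convexHull ℝ (V : Set (EuclideanSpace ℝ (Fin n)))

/-- A facet of `P` is a non-empty face of `P` whose dimension is one less than that of `P`.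
A non-empty face is the set of maximizers over `P` of some linear functional. -/
def IsFacet {n : ℕ} (P F : Set (EuclideanSpace ℝ (Fin n))) : Prop :=
  IsExposed ℝ P F ∧ ∃ d : ℕ, HasDim P (d + 1) ∧ HasDim F d

/-! A maximal set M is closed, since passing to the closure of a convex set with interior points
keeps the interior. It is bounded: a recession direction at an interior lattice point would produce
infinitely many more, because rays pass close to lattice points (`exists_integerPoint_near_ray`).
This uses k ≥ 1. Separating M from the nearby lattice points outside its interior encloses M in a
bounded polyhedron with the same interior lattice points, so by maximality M is that polyhedron. A
facet with no lattice point in its relative interior could be pushed outwards a little,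
contradicting maximality.

Conversely, a larger convex set has a point beyond some facet (`exists_facet_beyond`), so the
relative interior of that facet, including a lattice point, becomes interior
(`mem_interior_of_beyond_facet`). -/

section ConvexGeometry

/-! ### Faces, facets and polyhedra -/

variable {E : Type*} [NormedAddCommGroup E] [NormedSpace ℝ E]

/-- A nonzero functional attains no maximum at an interior point. -/
theorem lt_of_mem_interior_of_forall_le {P : Set E} {l : StrongDual ℝ E} (hl : l ≠ 0) {b : ℝ}
    (hb : ∀ y ∈ P, l y ≤ b) {p : E} (hp : p ∈ interior P) : l p < b := by
  refine lt_of_le_of_ne (hb p (interior_subset hp)) fun h => hl ?_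
  have hmax : IsLocalMax l p := by
    filter_upwards [mem_interior_iff_mem_nhds.1 hp] with y hy
    exact h ▸ hb y hy
  exact hmax.hasFDerivAt_eq_zero l.hasFDerivAt

/-- A functional that is maximal over `F` at a relative interior point is constant on `F`. -/
theorem eq_of_mem_intrinsicInterior_of_forall_le {F : Set E} {g : StrongDual ℝ E} {c : E}
    (hc : c ∈ intrinsicInterior ℝ F) (hg : ∀ y ∈ F, g y ≤ g c) {y : E} (hy : y ∈ F) :
    g y = g c := by
  obtain ⟨c', hc', rfl⟩ := mem_intrinsicInterior.1 hc
  -- The line from c to y stays in F slightly beyond c, at some t < 0; maximality at c there forces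
  -- g y ≥ g c.
  let γ : ℝ → affineSpan ℝ F := fun t =>
    ⟨AffineMap.lineMap (c' : E) y t, AffineMap.lineMap_mem t c'.2 (subset_affineSpan ℝ F hy)⟩
  have hγ : Continuous γ := by
    refine Continuous.subtype_mk ?_ _
    exact AffineMap.lineMap_continuous
  have h0 : γ 0 = c' := by ext; simp [γ]
  have hev : ∀ᶠ t in nhds (0 : ℝ), γ t ∈ ((↑) ⁻¹' F : Set (affineSpan ℝ F)) :=
    hγ.continuousAt.eventually (by rw [h0]; exact mem_interior_iff_mem_nhds.1 hc')
  obtain ⟨t, htF, ht⟩ := ((hev.filter_mono nhdsWithin_le_nhds).and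
    (self_mem_nhdsWithin (s := Set.Iio (0 : ℝ)))).exists
  have h1 := hg _ htF
  simp only [γ, AffineMap.lineMap_apply, vsub_eq_sub, vadd_eq_add, map_add, map_smul, map_sub,
    smul_eq_mul] at h1
  have h2 := hg y hy
  have : t < 0 := ht
  nlinarith

theorem vectorSpan_le_ker {F : Set E} {g : StrongDual ℝ E} {b : ℝ} (hg : ∀ y ∈ F, g y = b) :
    vectorSpan ℝ F ≤ LinearMap.ker (g : E →ₗ[ℝ] ℝ) := by
  rw [vectorSpan_def, Submodule.span_le]
  rintro _ ⟨x, hx, y, hy, rfl⟩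
  simp [hg x hx, hg y hy]

/-- The polyhedron cut out by a set of linear inequalities. -/
def polyhedron (T : Set (StrongDual ℝ E × ℝ)) : Set E := {x | ∀ t ∈ T, t.1 x ≤ t.2}

theorem convex_polyhedron (T : Set (StrongDual ℝ E × ℝ)) : Convex ℝ (polyhedron T) := by
  have : polyhedron T = ⋂ t ∈ T, {x | t.1 x ≤ t.2} := by ext; simp [polyhedron]
  rw [this]
  exact convex_iInter₂ fun t _ => convex_halfSpace_le t.1.isLinear t.2

theorem isClosed_polyhedron (T : Set (StrongDual ℝ E × ℝ)) : IsClosed (polyhedron T) := by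
  have : polyhedron T = ⋂ t ∈ T, {x | t.1 x ≤ t.2} := by ext; simp [polyhedron]
  rw [this]
  exact isClosed_biInter fun t _ => isClosed_le t.1.continuous continuous_const

/-- An extreme point is determined by its set of tight constraints, and there are finitely many such
sets. -/
theorem finite_extremePoints_polyhedron {T : Set (StrongDual ℝ E × ℝ)} (hT : T.Finite) :
    ((polyhedron T).extremePoints ℝ).Finite := by
  refine Set.Finite.of_injOn (f := fun x => {t ∈ T | t.1 x = t.2}) (t := {A | A ⊆ T})
    (fun x _ => Set.sep_subset _ _) ?_ hT.finite_subsets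
  intro x hx y hy hxy
  have hxy' : ∀ t ∈ T, t.1 x = t.2 → t.1 y = t.2 := fun t ht h => by
    have : t ∈ {t ∈ T | t.1 x = t.2} := ⟨ht, h⟩
    exact ((Set.ext_iff.1 hxy t).1 this).2
  -- Constraints tight at x are tight at y, hence along the whole line; slack ones allow small s. So
  -- x lies strictly between y and a point of the polyhedron.
  have hev : ∀ᶠ s in nhds (0 : ℝ), ∀ t ∈ T, t.1 (x + s • (x - y)) ≤ t.2 := by
    rw [Filter.eventually_all_finite hT]
    intro t ht
    rcases (hx.1 t ht).eq_or_lt with h | h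
    · exact Filter.Eventually.of_forall fun s => by simp [h, hxy' t ht h]
    · have hc : Continuous fun s : ℝ => t.1 (x + s • (x - y)) := by fun_prop
      filter_upwards [hc.continuousAt.eventually_lt continuousAt_const (by simpa using h)]
        with s hs using hs.le
  obtain ⟨s, hsT, hs⟩ := ((hev.filter_mono nhdsWithin_le_nhds).and
    (self_mem_nhdsWithin (s := Set.Ioi (0 : ℝ)))).exists
  have hs : 0 < s := hs
  refine (hx.2 hy.1 hsT ⟨s / (1 + s), 1 / (1 + s), by positivity, by positivity,
    by field_simp; ring, ?_⟩).symm
  have : (1 / (1 + s)) * (1 + s) = 1 := by field_simp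
  calc (s / (1 + s)) • y + (1 / (1 + s)) • (x + s • (x - y))
      = ((1 / (1 + s)) * (1 + s)) • x := by
        rw [div_eq_mul_one_div s]; module
    _ = x := by rw [this, one_smul]

variable [FiniteDimensional ℝ E]

theorem finrank_ker_add_one {l : StrongDual ℝ E} (hl : l ≠ 0) :
    Module.finrank ℝ (LinearMap.ker (l : E →ₗ[ℝ] ℝ)) + 1 = Module.finrank ℝ E := by
  have h := LinearMap.finrank_range_add_finrank_ker (l : E →ₗ[ℝ] ℝ)
  have hl' : (l : E →ₗ[ℝ] ℝ) ≠ 0 := fun h => hl (by ext x; exact LinearMap.congr_fun h x)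
  rw [LinearMap.range_eq_top.2 (LinearMap.surjective hl'), finrank_top, Module.finrank_self] at h
  omega

/-- Two functionals that vanish on a common hyperplane are proportional. -/
theorem exists_eq_smul_of_le_ker {l g : StrongDual ℝ E} (hl : l ≠ 0) {W : Submodule ℝ E}
    (hW : Module.finrank ℝ W + 1 = Module.finrank ℝ E) (hlW : W ≤ LinearMap.ker (l : E →ₗ[ℝ] ℝ))
    (hgW : W ≤ LinearMap.ker (g : E →ₗ[ℝ] ℝ)) : ∃ a : ℝ, ∀ x, g x = a * l x := by
  have hker : W = LinearMap.ker (l : E →ₗ[ℝ] ℝ) :=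
    Submodule.eq_of_le_of_finrank_eq hlW (by have := finrank_ker_add_one hl; omega)
  have h : (g : E →ₗ[ℝ] ℝ) ∈ Submodule.span ℝ (Set.range fun _ : Unit => (l : E →ₗ[ℝ] ℝ)) :=
    mem_span_of_iInf_ker_le_ker (by simpa [hker] using hgW)
  rw [Set.range_const, Submodule.mem_span_singleton] at h
  obtain ⟨a, ha⟩ := h
  exact ⟨a, fun x => by simpa using (LinearMap.congr_fun ha x).symm⟩

/-- A convex set that contains a full-dimensional set `P` and a point strictly beyond a facet `F`
of `P` has the relative interior of `F` in its interior. -/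
theorem mem_interior_of_beyond_facet {F P K : Set E} {l : StrongDual ℝ E} {x p z : E}
    (hF : Module.finrank ℝ (vectorSpan ℝ F) + 1 = Module.finrank ℝ E) (hFP : F ⊆ P)
    (hlF : ∀ y ∈ F, l y = l z) (hz : z ∈ intrinsicInterior ℝ F) (hP : (interior P).Nonempty)
    (hK : Convex ℝ K) (hPK : P ⊆ K) (hx : x ∈ K) (hzx : l z < l x) (hp : p ∈ P)
    (hpz : l p < l z) : z ∈ interior K := by
  by_contra hzK
  -- A functional supporting K at z is constant on F, so it is a multiple a of l; x forces a ≤ 0 and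
  -- p forces a ≥ 0.
  obtain ⟨g, hg0, hg⟩ := geometric_hahn_banach_of_nonempty_interior_point hK hzK
    (hP.mono (interior_mono hPK))
  have hl0 : l ≠ 0 := by rintro rfl; simp at hzx
  have hgF : ∀ y ∈ F, g y = g z := fun y hy =>
    eq_of_mem_intrinsicInterior_of_forall_le hz (fun w hw => hg w (hPK (hFP hw))) hy
  obtain ⟨a, ha⟩ := exists_eq_smul_of_le_ker hl0 hF (vectorSpan_le_ker hlF) (vectorSpan_le_ker hgF)
  have h1 := hg x hx
  have h2 := hg p (hPK hp)
  simp only [ha] at h1 h2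
  have h3 : a = 0 := le_antisymm (by nlinarith) (by nlinarith)
  exact hg0 (by ext y; simp [ha, h3])

/-- A point outside a full-dimensional polytope is strictly beyond some facet. -/
theorem exists_facet_beyond {V : Set E} (hV : V.Finite)
    (hint : (interior (convexHull ℝ V)).Nonempty) {x : E} (hx : x ∉ convexHull ℝ V) :
    ∃ l : StrongDual ℝ E,
      (l.toExposed (convexHull ℝ V)).Nonempty ∧
      Module.finrank ℝ (vectorSpan ℝ (l.toExposed (convexHull ℝ V))) + 1 = Module.finrank ℝ E ∧
      (∀ z ∈ l.toExposed (convexHull ℝ V), l z < l x) ∧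
      ∃ p ∈ convexHull ℝ V, ∀ z ∈ l.toExposed (convexHull ℝ V), l p < l z := by
  set P := convexHull ℝ V with hPdef
  have hPc : IsCompact P := hV.isCompact_convexHull ℝ
  have hPcv : Convex ℝ P := convex_convexHull ℝ V
  -- A generic p avoids finitely many null sets, so that the segment from p to x leaves P through a
  -- facet and not through a smaller face.
  obtain ⟨p, hp, hgen⟩ : ∃ p ∈ interior P, ∀ W ⊆ V, affineSpan ℝ (insert x W) ≠ ⊤ →
      p ∉ affineSpan ℝ (insert x W) := by
    borelize E
    let μ : MeasureTheory.Measure E := MeasureTheory.Measure.addHaar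
    have hfin : {W | W ⊆ V ∧ affineSpan ℝ (insert x W) ≠ ⊤}.Finite :=
      hV.finite_subsets.subset fun W hW => hW.1
    have hnull : μ (⋃ W ∈ {W | W ⊆ V ∧ affineSpan ℝ (insert x W) ≠ ⊤},
        (affineSpan ℝ (insert x W) : Set E)) = 0 := by
      rw [MeasureTheory.measure_biUnion_null_iff hfin.countable]
      exact fun W hW => MeasureTheory.Measure.addHaar_affineSubspace μ _ hW.2
    by_contra! hcon
    refine (isOpen_interior.measure_pos μ hint).ne' (MeasureTheory.measure_mono_null ?_ hnull)
    intro q hq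
    obtain ⟨W, hWV, hW, hqW⟩ := hcon q hq
    exact Set.mem_biUnion (x := W) ⟨hWV, hW⟩ hqW
  obtain ⟨y, hyseg, hyfr⟩ : (segment ℝ p x ∩ frontier P).Nonempty := by
    by_contra hfr
    obtain ⟨y, hy, hyint⟩ := (convex_segment p x).isPreconnected (interior P) Pᶜ
      isOpen_interior hPc.isClosed.isOpen_compl
      (fun y hy => by
        by_contra hcon
        exact hfr ⟨y, hy, subset_closure (not_not.1 fun h => hcon (Or.inr h)),
          fun h => hcon (Or.inl h)⟩)
      ⟨p, left_mem_segment ℝ p x, hp⟩ ⟨x, right_mem_segment ℝ p x, hx⟩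
    exact hyint.2 (interior_subset hyint.1)
  have hyP : y ∈ P := hPc.isClosed.frontier_subset hyfr
  have hyint : y ∉ interior P := hyfr.2
  obtain ⟨l, hl0, hl⟩ := geometric_hahn_banach_of_nonempty_interior_point hPcv hyint hint
  have hlp : l p < l y := lt_of_mem_interior_of_forall_le hl0 hl hp
  set F := l.toExposed P with hFdef
  have hyF : y ∈ F := ⟨hyP, hl⟩
  have hlF : ∀ z ∈ F, l z = l y := fun z hz => le_antisymm (hl z hz.1) (hz.2 y hyP)
  have hFexp : IsExposed ℝ P F := ContinuousLinearMap.toExposed.isExposed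
  obtain ⟨t, ht, hty⟩ : ∃ t ∈ Set.Icc (0 : ℝ) 1, AffineMap.lineMap p x t = y := by
    rw [segment_eq_image_lineMap] at hyseg; exact hyseg
  have hly : l y = l p + t * (l x - l p) := by
    rw [← hty]; simp [AffineMap.lineMap_apply]; ring
  have ht0 : 0 < t := lt_of_le_of_ne ht.1 (by rintro rfl; simp at hly; linarith)
  have ht1 : t < 1 := lt_of_le_of_ne ht.2 (by rintro rfl; simp at hty; exact hx (hty ▸ hyP))
  have hlx : l y < l x := by nlinarith
  -- By Krein–Milman, F is the hull of its extreme points, which all belong to V.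
  have hyspan : y ∈ affineSpan ℝ (V ∩ F) := by
    have hyc : y ∈ convexHull ℝ (V ∩ F) := by
      have h1 := closure_convexHull_extremePoints (hFexp.isCompact hPc) (hFexp.convex hPcv)
      have h2 : F.extremePoints ℝ ⊆ V ∩ F := fun w hw =>
        ⟨extremePoints_convexHull_subset
          (hFexp.isExtreme.extremePoints_subset_extremePoints hw), hw.1⟩
      have h3 : closure (convexHull ℝ (F.extremePoints ℝ)) ⊆ convexHull ℝ (V ∩ F) :=
        closure_minimal (convexHull_mono h2)
          (((hV.subset Set.inter_subset_left).isCompact_convexHull ℝ).isClosed)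
      exact h3 (h1.symm ▸ hyF)
    exact convexHull_subset_affineSpan _ hyc
  have htop : affineSpan ℝ (insert x (V ∩ F)) = ⊤ := by
    by_contra hne
    refine hgen _ Set.inter_subset_left hne ?_
    -- Since y - x = (1 - t)(p - x), p lies on the line through x and y, against genericity.
    have hp' : p = AffineMap.lineMap x y (1 / (1 - t)) := by
      have h1t : (1 - t) ≠ 0 := by linarith
      rw [← hty]
      simp only [AffineMap.lineMap_apply, vsub_eq_sub, vadd_eq_add]
      have : t • (x - p) + p - x = (1 - t) • (p - x) := by module
      rw [this, smul_smul, one_div, inv_mul_cancel₀ h1t]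
      module
    rw [hp']
    exact AffineMap.lineMap_mem _ (subset_affineSpan ℝ _ (Set.mem_insert _ _))
      (affineSpan_mono ℝ (Set.subset_insert _ _) hyspan)
  refine ⟨l, ⟨y, hyF⟩, ?_, fun z hz => by rw [hlF z hz]; exact hlx,
    p, interior_subset hp, fun z hz => by rw [hlF z hz]; exact hlp⟩
  change Module.finrank ℝ (vectorSpan ℝ F) + 1 = Module.finrank ℝ E
  have hup := Submodule.finrank_mono (vectorSpan_le_ker hlF)
  have hker := finrank_ker_add_one hl0
  have h1 := finrank_vectorSpan_insert_le_set ℝ (V ∩ F) x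
  have h2 : vectorSpan ℝ (insert x (V ∩ F)) = ⊤ := by
    rw [← direction_affineSpan, htop, AffineSubspace.direction_top]
  rw [h2, finrank_top] at h1
  have h3 := Submodule.finrank_mono (vectorSpan_mono ℝ (Set.inter_subset_right : V ∩ F ⊆ F))
  omega

/-- A bounded polyhedron is the convex hull of its finitely many extreme points. -/
theorem convexHull_extremePoints_polyhedron {T : Set (StrongDual ℝ E × ℝ)} (hT : T.Finite)
    (hb : Bornology.IsBounded (polyhedron T)) :
    convexHull ℝ ((polyhedron T).extremePoints ℝ) = polyhedron T := by
  have hc : IsCompact (polyhedron T) := Metric.isCompact_of_isClosed_isBounded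
    (isClosed_polyhedron T) hb
  have h := closure_convexHull_extremePoints hc (convex_polyhedron T)
  rwa [((finite_extremePoints_polyhedron hT).isCompact_convexHull ℝ).isClosed.closure_eq] at h

end ConvexGeometry

/-! ### Lattice points and boundedness -/

section IntegerPoints

variable {n : ℕ}

theorem sub_mem_integerPoints {x y : EuclideanSpace ℝ (Fin n)} (hx : x ∈ integerPoints n)
    (hy : y ∈ integerPoints n) : x - y ∈ integerPoints n := fun i => by
  obtain ⟨a, ha⟩ := hx i
  obtain ⟨b, hb⟩ := hy i
  exact ⟨a - b, by simp [ha, hb]⟩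

theorem add_mem_integerPoints {x y : EuclideanSpace ℝ (Fin n)} (hx : x ∈ integerPoints n)
    (hy : y ∈ integerPoints n) : x + y ∈ integerPoints n := fun i => by
  obtain ⟨a, ha⟩ := hx i
  obtain ⟨b, hb⟩ := hy i
  exact ⟨a + b, by simp [ha, hb]⟩

theorem finite_integerPoints_inter {B : Set (EuclideanSpace ℝ (Fin n))}
    (hB : Bornology.IsBounded B) : (integerPoints n ∩ B).Finite := by
  obtain ⟨R, hR⟩ := hB.exists_norm_le
  refine ((Set.finite_Icc (fun _ : Fin n => -⌈R⌉) (fun _ => ⌈R⌉)).image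
    fun z => WithLp.toLp 2 fun i => (z i : ℝ)).subset ?_
  rintro x ⟨hx, hxB⟩
  choose z hz using hx
  have habs : ∀ i, |(z i : ℝ)| ≤ ⌈R⌉ := fun i => by
    have h1 := (PiLp.norm_apply_le x i).trans ((hR x hxB).trans (Int.le_ceil R))
    rwa [hz i, Real.norm_eq_abs] at h1
  refine ⟨z, ⟨fun i => ?_, fun i => ?_⟩, ?_⟩
  · have := (abs_le.1 (habs i)).1
    exact_mod_cast this
  · have := (abs_le.1 (habs i)).2
    exact_mod_cast this
  · ext i
    simp [hz i]

/-- Every ray passes arbitrarily close to integer points arbitrarily far away. -/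
theorem exists_integerPoint_near_ray {u : EuclideanSpace ℝ (Fin n)} (hu : u ≠ 0) {ε : ℝ}
    (hε : 0 < ε) (R : ℝ) :
    ∃ z ∈ integerPoints n, ∃ t : ℝ, 0 ≤ t ∧ ‖z - t • u‖ < ε ∧ R < ‖z‖ := by
  -- Dirichlet's argument: the remainders of m • u modulo the lattice lie in a compact set, so a
  -- subsequence is Cauchy, and differences of the rounded points lie near the ray.
  let w : ℕ → EuclideanSpace ℝ (Fin n) := fun m =>
    WithLp.toLp 2 fun i => ((⌊((m : ℝ) • u) i⌋ : ℤ) : ℝ)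
  have hw : ∀ m, w m ∈ integerPoints n := fun m i => ⟨_, rfl⟩
  let r : ℕ → EuclideanSpace ℝ (Fin n) := fun m => (m : ℝ) • u - w m
  have hr : ∀ m, r m ∈ Metric.closedBall (0 : EuclideanSpace ℝ (Fin n)) (Real.sqrt n) := by
    intro m
    rw [mem_closedBall_zero_iff, EuclideanSpace.norm_eq]
    refine Real.sqrt_le_sqrt ?_
    calc ∑ i, ‖r m i‖ ^ 2 ≤ ∑ _i : Fin n, (1 : ℝ) := by
          refine Finset.sum_le_sum fun i _ => ?_
          have h1 : r m i = Int.fract (((m : ℝ) • u) i) := rfl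
          rw [h1, Real.norm_eq_abs, sq_abs]
          have h2 := Int.fract_nonneg (((m : ℝ) • u) i)
          have h3 := (Int.fract_lt_one (((m : ℝ) • u) i)).le
          nlinarith
      _ = n := by simp
  obtain ⟨a, -, φ, hφ, hlim⟩ := (isCompact_closedBall _ _).tendsto_subseq hr
  obtain ⟨N, hN⟩ := Metric.cauchySeq_iff'.1 hlim.cauchySeq ε hε
  have hu0 : 0 < ‖u‖ := norm_pos_iff.2 hu
  obtain ⟨j, hj⟩ := exists_nat_gt ((R + ε) / ‖u‖ + φ N)
  let k := max N j
  have hNk : φ N ≤ φ k := hφ.monotone (le_max_left _ _)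
  have hjk : (j : ℝ) ≤ φ k := by exact_mod_cast (le_max_right N j).trans (hφ.id_le k)
  have hclose : ‖(w (φ k) - w (φ N)) - ((φ k : ℝ) - φ N) • u‖ < ε := by
    have h1 := hN k (le_max_left _ _)
    rw [dist_comm, dist_eq_norm] at h1
    have h2 : w (φ k) - w (φ N) - ((φ k : ℝ) - φ N) • u = (r ∘ φ) N - (r ∘ φ) k := by
      change _ = ((φ N : ℝ) • u - w (φ N)) - ((φ k : ℝ) • u - w (φ k))
      module
    rwa [h2]
  refine ⟨w (φ k) - w (φ N), sub_mem_integerPoints (hw _) (hw _), (φ k : ℝ) - φ N,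
    sub_nonneg.2 (by exact_mod_cast hNk), hclose, ?_⟩
  have h1 : (R + ε) / ‖u‖ < (φ k : ℝ) - φ N := by linarith
  rw [div_lt_iff₀ hu0] at h1
  have h2 : ‖((φ k : ℝ) - φ N) • u‖ = ((φ k : ℝ) - φ N) * ‖u‖ := by
    rw [norm_smul, Real.norm_of_nonneg (sub_nonneg.2 (by exact_mod_cast hNk))]
  have h3 := norm_sub_norm_le (((φ k : ℝ) - φ N) • u) (w (φ k) - w (φ N))
  rw [norm_sub_rev (((φ k : ℝ) - φ N) • u)] at h3
  linarith

/-- A closed convex set with finitely many, but at least one, interior integer points is bounded. -/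
theorem isBounded_of_finite_interior_integerPoints {M : Set (EuclideanSpace ℝ (Fin n))}
    (hM : Convex ℝ M) (hMc : IsClosed M) (hfin : (interior M ∩ integerPoints n).Finite)
    (hne : (interior M ∩ integerPoints n).Nonempty) : Bornology.IsBounded M := by
  by_contra hb
  obtain ⟨u, hu, huM⟩ := not_bounded_iff_exists_ne_zero_mem_asymptoticCone.1 hb
  obtain ⟨p, hp, hpZ⟩ := hne
  obtain ⟨ε, hε, hball⟩ := Metric.isOpen_iff.1 isOpen_interior p hp
  obtain ⟨R, hR⟩ := hfin.isBounded.exists_norm_le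
  obtain ⟨z, hz, t, ht, hzt, hRz⟩ := exists_integerPoint_near_ray hu hε (R + ‖p‖)
  -- Translating a ball around p along the recession direction keeps it in M.
  have hsub : Metric.ball (p + t • u) ε ⊆ M := by
    intro y hy
    have hy' : y - t • u ∈ M := interior_subset (hball (by
      rw [mem_ball_iff_norm] at hy ⊢
      convert hy using 2
      abel))
    have := hM.smul_vadd_mem_of_isClosed_of_mem_asymptoticCone hMc ht huM hy'
    simpa using this
  have hin : p + z ∈ interior M := by
    refine interior_maximal hsub Metric.isOpen_ball ?_
    rw [mem_ball_iff_norm]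
    simpa using hzt
  have h1 := hR _ ⟨hin, add_mem_integerPoints hpZ hz⟩
  have h2 := norm_sub_norm_le z (-p)
  rw [sub_neg_eq_add, norm_neg, add_comm z p] at h2
  linarith

end IntegerPoints

/-! ### Polyhedral enclosure and pushing out a facet -/

section MaximalSets

variable {n : ℕ} {M : Set (EuclideanSpace ℝ (Fin n))}

/-- A bounded closed convex set with nonempty interior lies in a bounded polyhedron with the same
interior integer points. -/
theorem exists_polyhedron_interior_integerPoints (hM : Convex ℝ M) (hb : Bornology.IsBounded M)
    (hint : (interior M).Nonempty) :
    ∃ T : Set (StrongDual ℝ (EuclideanSpace ℝ (Fin n)) × ℝ), T.Finite ∧ M ⊆ polyhedron T ∧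
      Bornology.IsBounded (polyhedron T) ∧
      interior (polyhedron T) ∩ integerPoints n = interior M ∩ integerPoints n := by
  obtain ⟨R, hR⟩ := hb.exists_norm_le
  -- A box around M leaves only finitely many lattice points to cut off.
  let T₀ : Set (StrongDual ℝ (EuclideanSpace ℝ (Fin n)) × ℝ) :=
    Set.range (fun i => (EuclideanSpace.proj i, R)) ∪
      Set.range (fun i => (-EuclideanSpace.proj i, R))
  have hT₀ : T₀.Finite := (Set.finite_range _).union (Set.finite_range _)
  have hbox : ∀ x ∈ polyhedron T₀, ∀ i, ‖x i‖ ≤ R := fun x hx i => by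
    have h1 := hx _ (Or.inl ⟨i, rfl⟩)
    have h2 := hx _ (Or.inr ⟨i, rfl⟩)
    exact abs_le.2 ⟨neg_le.1 h2, h1⟩
  have hT₀b : Bornology.IsBounded (polyhedron T₀) := by
    refine (Metric.isBounded_closedBall (x := (0 : EuclideanSpace ℝ (Fin n)))
      (r := Real.sqrt (∑ _i : Fin n, R ^ 2))).subset fun x hx => ?_
    rw [mem_closedBall_zero_iff, EuclideanSpace.norm_eq]
    refine Real.sqrt_le_sqrt (Finset.sum_le_sum fun i _ => ?_)
    exact pow_le_pow_left₀ (norm_nonneg _) (hbox x hx i) 2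
  have hMT₀ : M ⊆ polyhedron T₀ := by
    intro x hx t ht
    have h : ∀ i, |x i| ≤ R := fun i => (PiLp.norm_apply_le x i).trans (hR x hx)
    rcases ht with ⟨i, rfl⟩ | ⟨i, rfl⟩
    · simpa using (abs_le.1 (h i)).2
    · simpa using neg_le.1 (abs_le.1 (h i)).1
  have hsep : ∀ z : EuclideanSpace ℝ (Fin n), ∃ f : StrongDual ℝ (EuclideanSpace ℝ (Fin n)),
      z ∉ interior M → f ≠ 0 ∧ ∀ a ∈ M, f a ≤ f z := fun z => by
    by_cases hz : z ∈ interior M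
    · exact ⟨0, fun h => absurd hz h⟩
    · obtain ⟨f, hf⟩ := geometric_hahn_banach_of_nonempty_interior_point hM hz hint
      exact ⟨f, fun _ => hf⟩
  choose f hf using hsep
  let Z : Set (EuclideanSpace ℝ (Fin n)) := (integerPoints n ∩ polyhedron T₀) \ interior M
  have hZ : Z.Finite := (finite_integerPoints_inter hT₀b).sdiff
  let T := T₀ ∪ (fun z => (f z, f z z)) '' Z
  have hTT₀ : polyhedron T ⊆ polyhedron T₀ := fun x hx t ht => hx t (Or.inl ht)
  have hMT : M ⊆ polyhedron T := by
    rintro x hx t (ht | ⟨z, hz, rfl⟩)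
    · exact hMT₀ hx t ht
    · exact (hf z hz.2).2 x hx
  refine ⟨T, hT₀.union (hZ.image _), hMT, hT₀b.subset hTT₀, ?_⟩
  refine Set.Subset.antisymm ?_ (Set.inter_subset_inter_left _ (interior_mono hMT))
  rintro z ⟨hzT, hzZ⟩
  refine ⟨?_, hzZ⟩
  by_contra hzM
  have hz : z ∈ Z := ⟨⟨hzZ, hTT₀ (interior_subset hzT)⟩, hzM⟩
  exact lt_irrefl _ (lt_of_mem_interior_of_forall_le (hf z hzM).1
    (fun y (hy : y ∈ polyhedron T) => hy _ (Or.inr ⟨z, hz, rfl⟩)) hzT)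

/-- A facet of a bounded polyhedron without integer points in its relative interior can be pushed
outwards without creating new interior integer points. -/
theorem exists_convex_ssuperset_of_facet
    {T : Set (StrongDual ℝ (EuclideanSpace ℝ (Fin n)) × ℝ)} (hT : T.Finite)
    (hb : Bornology.IsBounded (polyhedron T)) (hint : (interior (polyhedron T)).Nonempty)
    {l : StrongDual ℝ (EuclideanSpace ℝ (Fin n))} (hl : l ≠ 0)
    (hne : (l.toExposed (polyhedron T)).Nonempty)
    (hdim : Module.finrank ℝ (vectorSpan ℝ (l.toExposed (polyhedron T))) + 1 = n)
    (hZ : ¬ (intrinsicInterior ℝ (l.toExposed (polyhedron T)) ∩ integerPoints n).Nonempty) :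
    ∃ K : Set (EuclideanSpace ℝ (Fin n)), Convex ℝ K ∧ polyhedron T ⊆ K ∧ polyhedron T ≠ K ∧
      interior K ∩ integerPoints n = interior (polyhedron T) ∩ integerPoints n := by
  set M := polyhedron T with hMdef
  set F := l.toExposed M with hFdef
  have hFcv : Convex ℝ F :=
    (ContinuousLinearMap.toExposed.isExposed (A := M) (l := l)).convex (convex_polyhedron T)
  obtain ⟨c, hc⟩ := hne.intrinsicInterior hFcv
  have hcF : c ∈ F := intrinsicInterior_subset hc
  have hlF : ∀ z ∈ F, l z = l c := fun z hz => le_antisymm (hcF.2 z hz.1) (hz.2 c hcF.1)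
  have hlM : ∀ y ∈ M, l y ≤ l c := hcF.2
  obtain ⟨p, hp⟩ := hint
  have hlp : l p < l c := lt_of_mem_interior_of_forall_le hl hlM hp
  -- A constraint tight at the relative interior point c is tight on all of F, hence a nonnegative
  -- multiple of l ≤ l c.
  have hactive : ∀ t ∈ T, ¬ t.1 c < t.2 → ∀ y, l y ≤ l c → t.1 y ≤ t.2 := by
    intro t ht htc y hy
    have htc' : t.1 c = t.2 := le_antisymm (hcF.1 t ht) (not_lt.1 htc)
    have htF : ∀ z ∈ F, t.1 z = t.1 c := fun z hz =>
      eq_of_mem_intrinsicInterior_of_forall_le hc (fun w hw => htc' ▸ hw.1 t ht) hz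
    obtain ⟨a, ha⟩ := exists_eq_smul_of_le_ker hl (by simpa using hdim)
      (vectorSpan_le_ker hlF) (vectorSpan_le_ker htF)
    have h1 := interior_subset hp t ht
    rw [← htc'] at h1 ⊢
    simp only [ha] at h1 ⊢
    have ha0 : 0 ≤ a := by nlinarith
    exact mul_le_mul_of_nonneg_left hy ha0
  obtain ⟨v, hv⟩ : ∃ v, l v = 1 := by
    have hl' : (l : EuclideanSpace ℝ (Fin n) →ₗ[ℝ] ℝ) ≠ 0 :=
      fun h => hl (by ext x; exact LinearMap.congr_fun h x)
    exact LinearMap.surjective hl' 1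
  obtain ⟨R, hR⟩ := hb.subset_ball 0
  have hZfin : {z ∈ integerPoints n ∩ Metric.ball 0 R | l c < l z}.Finite :=
    (finite_integerPoints_inter Metric.isBounded_ball).subset (Set.sep_subset _ _)
  have hcont : Continuous fun ε : ℝ => c + ε • v := by fun_prop
  -- Small ε keeps the pushed facet short of every lattice point of the ball beyond F, and keeps c +
  -- ε • v inside K, defined below.
  have h1 : ∀ᶠ ε in nhds (0 : ℝ), ∀ z ∈ {z ∈ integerPoints n ∩ Metric.ball 0 R | l c < l z},
      l c + ε < l z := by
    rw [Filter.eventually_all_finite hZfin]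
    intro z hz
    exact (continuous_const.add continuous_id).continuousAt.eventually_lt continuousAt_const
      (by simpa using hz.2)
  have h2 : ∀ᶠ ε in nhds (0 : ℝ), ∀ t ∈ {t ∈ T | t.1 c < t.2}, t.1 (c + ε • v) < t.2 := by
    rw [Filter.eventually_all_finite (hT.subset (Set.sep_subset _ _))]
    intro t ht
    exact (t.1.continuous.comp hcont).continuousAt.eventually_lt continuousAt_const
      (by simpa using ht.2)
  have h3 : ∀ᶠ ε in nhds (0 : ℝ), c + ε • v ∈ Metric.ball (0 : EuclideanSpace ℝ (Fin n)) R :=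
    hcont.continuousAt.eventually (Metric.isOpen_ball.mem_nhds (by simpa using hR hcF.1))
  obtain ⟨ε, ⟨⟨h1, h2⟩, h3⟩, hε⟩ := ((((h1.and h2).and h3).filter_mono nhdsWithin_le_nhds).and
    (self_mem_nhdsWithin (s := Set.Ioi (0 : ℝ)))).exists
  have hε : 0 < ε := hε
  -- The constraints tight at c are replaced by l ≤ l c + ε; the ball limits the lattice points that
  -- could enter.
  let K : Set (EuclideanSpace ℝ (Fin n)) :=
    polyhedron {t ∈ T | t.1 c < t.2} ∩ {y | l y ≤ l c + ε} ∩ Metric.ball 0 R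
  have hMK : M ⊆ K := fun y hy =>
    ⟨⟨fun t ht => hy t ht.1, (hlM y hy).trans (by linarith)⟩, hR hy⟩
  have hKM : ∀ y ∈ K, l y ≤ l c → y ∈ M := fun y hy hyc t ht => by
    by_cases htc : t.1 c < t.2
    · exact hy.1.1 t ⟨ht, htc⟩
    · exact hactive t ht htc y hyc
  refine ⟨K, ((convex_polyhedron _).inter (convex_halfSpace_le l.isLinear _)).inter
    (convex_ball _ _), hMK, fun hMeqK => ?_, ?_⟩
  · have hx : c + ε • v ∈ M := by
      rw [hMeqK]
      exact ⟨⟨fun t ht => (h2 t ht).le, by simp [hv]⟩, h3⟩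
    have := hlM _ hx
    simp [hv] at this
    linarith
  · refine Set.Subset.antisymm ?_ (Set.inter_subset_inter_left _ (interior_mono hMK))
    rintro z ⟨hzK, hzZ⟩
    refine ⟨?_, hzZ⟩
    have hlz : l z ≤ l c := by
      by_contra! hcz
      exact absurd (h1 z ⟨⟨hzZ, (interior_subset hzK).2⟩, hcz⟩)
        (not_lt.2 (interior_subset hzK).1.2)
    rcases hlz.lt_or_eq with hlt | heq
    · refine interior_maximal (t := interior K ∩ {y | l y < l c})
        (fun y hy => hKM y (interior_subset hy.1) (le_of_lt hy.2))
        (isOpen_interior.inter (isOpen_lt l.continuous continuous_const)) ⟨hzK, hlt⟩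
    -- On the hyperplane l = l c, K coincides with F, so an interior point of K there is relatively
    -- interior to F.
    · refine absurd ⟨z, ?_, hzZ⟩ hZ
      have hKF : ∀ y ∈ K, l y = l c → y ∈ F := fun y hy hyc =>
        ⟨hKM y hy hyc.le, fun w hw => (hlM w hw).trans hyc.ge⟩
      have hspan : ∀ y ∈ affineSpan ℝ F, l y = l c := fun y hy => by
        have hd := AffineSubspace.vsub_mem_direction hy (subset_affineSpan ℝ F hcF)
        rw [direction_affineSpan] at hd
        have := vectorSpan_le_ker hlF hd
        simpa [sub_eq_zero] using this
      refine mem_intrinsicInterior.2 ⟨⟨z, subset_affineSpan ℝ F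
        (hKF z (interior_subset hzK) heq)⟩, ?_, rfl⟩
      rw [mem_interior_iff_mem_nhds]
      filter_upwards [continuous_subtype_val.continuousAt.eventually
        (isOpen_interior.mem_nhds hzK)] with y hy
      exact hKF y (interior_subset hy) (hspan y y.2)

/-- A facet is the set of maximizers of a nonzero functional. -/
theorem IsFacet.exists_toExposed {P F : Set (EuclideanSpace ℝ (Fin n))} (h : IsFacet P F) :
    ∃ l : StrongDual ℝ (EuclideanSpace ℝ (Fin n)), l ≠ 0 ∧ F = l.toExposed P := by
  obtain ⟨hexp, d, hP, hF⟩ := h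
  obtain ⟨l, hl⟩ := hexp hF.1
  refine ⟨l, ?_, hl⟩
  rintro rfl
  -- The zero functional exposes all of P, whose dimension is too large.
  have : F = P := by rw [hl]; ext; simp
  have h1 := hF.2
  rw [this, hP.2] at h1
  omega

end MaximalSets

/-! ### The characterization -/

theorem mainTheorem7 (n : ℕ) (hn : 1 ≤ n) (k : ℕ) (hk : 1 ≤ k) :
    maximalConvexSets (integerPoints n) k =
      {P : Set (EuclideanSpace ℝ (Fin n)) |
        IsPolytope P ∧ HasDim P n ∧ (interior P ∩ integerPoints n).encard = (k : ℕ∞) ∧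
          ∀ F : Set (EuclideanSpace ℝ (Fin n)), IsFacet P F →
            (intrinsicInterior ℝ F ∩ integerPoints n).Nonempty} := by
  have hnonempty : ∀ A : Set (EuclideanSpace ℝ (Fin n)), A.encard = (k : ℕ∞) → A.Nonempty :=
    fun A hA => by
      rw [← Set.encard_pos, hA]
      exact_mod_cast hk
  ext M
  constructor
  · rintro ⟨hcv, hdim, hcard, hmax⟩
    have hne := hnonempty _ hcard
    have hint : (interior M).Nonempty := hne.mono Set.inter_subset_left
    have hfin : (interior M ∩ integerPoints n).Finite := Set.finite_of_encard_eq_coe hcard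
    have hclosed : IsClosed M := by
      rw [hmax (closure M) hcv.closure subset_closure
        (by rw [hcv.interior_closure_eq_interior_of_nonempty_interior hint])]
      exact isClosed_closure
    have hbdd := isBounded_of_finite_interior_integerPoints hcv hclosed hfin hne
    obtain ⟨T, hT, hMT, hTb, hTZ⟩ := exists_polyhedron_interior_integerPoints hcv hbdd hint
    obtain rfl : M = polyhedron T := hmax _ (convex_polyhedron T) hMT hTZ
    refine ⟨⟨(finite_extremePoints_polyhedron hT).toFinset, ?_⟩, hdim, hcard, fun F hF => ?_⟩
    · rw [Set.Finite.coe_toFinset, convexHull_extremePoints_polyhedron hT hTb]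
    · by_contra hZ
      obtain ⟨l, hl, rfl⟩ := hF.exists_toExposed
      obtain ⟨-, d, hd, hFd⟩ := hF
      obtain ⟨K, hK, hsub, hneq, hKZ⟩ := exists_convex_ssuperset_of_facet hT hTb hint hl hFd.1
        (by rw [hFd.2, ← hd.2, hdim.2]) hZ
      exact hneq (hmax K hK hsub hKZ)
  · rintro ⟨⟨V, rfl⟩, hdim, hcard, hfacet⟩
    refine ⟨convex_convexHull ℝ _, hdim, hcard, fun M' hM' hsub hZ => ?_⟩
    have hint : (interior (convexHull ℝ (V : Set (EuclideanSpace ℝ (Fin n))))).Nonempty :=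
      (hnonempty _ hcard).mono Set.inter_subset_left
    by_contra hne
    obtain ⟨x, hxM', hxP⟩ := Set.exists_of_ssubset (hsub.ssubset_of_ne hne)
    obtain ⟨l, hFne, hFdim, hlx, p, hp, hlp⟩ := exists_facet_beyond V.finite_toSet hint hxP
    have hFdim' := hFdim
    rw [finrank_euclideanSpace_fin] at hFdim'
    obtain ⟨z, hz, hzZ⟩ := hfacet _ ⟨ContinuousLinearMap.toExposed.isExposed, _,
      ⟨hdim.1, by rw [hdim.2, hFdim']⟩, hFne, rfl⟩
    have hzF := intrinsicInterior_subset hz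
    have hzint := mem_interior_of_beyond_facet hFdim (fun y hy => hy.1)
      (fun y hy => le_antisymm (hzF.2 y hy.1) (hy.2 z hzF.1)) hz hint hM' hsub hxM'
      (hlx z hzF) hp (hlp z hzF)
    have hzP : z ∈ interior (convexHull ℝ (V : Set (EuclideanSpace ℝ (Fin n)))) :=
      (hZ.subset ⟨hzint, hzZ⟩).1
    have hl0 : l ≠ 0 := by
      rintro rfl
      simpa using hlp z hzF
    -- As a lattice point, z would be interior to P too, yet l attains its maximum over P at z.
    exact lt_irrefl _ (lt_of_mem_interior_of_forall_le hl0 hzF.2 hzP)
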